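/- Let $\mathbb{F}$ be an infinite field of arbitrary characteristic and let $d\ge 0$. For $n\ge 1$ let $R=R_{n,d}=\mathbb{F}[x_{ij}(k)\mid 1\le i,j\le n,\ 1\le k\le d]$, let $X_k=(x_{ij}(k))_{1\le i,j\le n}$ be the generic $n\times n$ matrices, and let $GL(n)=GL_n(\mathbb{F})$ act on $R$ by $g\cdot x_{ij}(k)=(g^{-1}X_kg)_{ij}$, with algebra of invariants $R^{GL(n)}$. For an $n\times n$ matrix $A$ define $\sigma_t(A)$ by $\det(A+\lambda E)=\sum_{t=0}^n\lambda^{n-t}\sigma_t(A)$, and for a word $a=x_{k_1}\cdots x_{k_r}$ put $X_a=X_{k_1}\cdots X_{k_r}$. A nonempty word in $x_1,\dots,x_d$ is called primitive if it is not a power of a shorter word; two words are cyclically equivalent if one is a cyclic rotation of the other. Let $\mathcal{N}_\sigma$ be the commutative polynomial algebra over $\mathbb{F}$ freely generated by symbols $\sigma_t(a)$, where $t>0$ is an integer and $a$ ranges over the primitive words up to cyclic equivalence. Let $\Psi_n:\mathcal{N}_\sigma\to R^{GL(n)}$ be the $\mathbb{F}$-algebra homomorphism with $\sigma_t(a)\mapsto\sigma_t(X_a)$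 for $t\le n$ and $\sigma_t(a)\mapsto 0$ for $t>n$, and let $K_n=\ker\Psi_n$. Then the ideal of free relations $K_\infty=\bigcap_{n>0}K_n$ is zero. -/

import Mathlib

namespace MatrixInvariants

open MvPolynomial

/-- A nonempty word in the letters `x_1, …, x_d` is primitive if it is not a power of a shorter
word. -/
def IsPrimitive {d : ℕ} (a : FreeMonoid (Fin d)) : Prop :=
  a ≠ 1 ∧ ∀ (b : FreeMonoid (Fin d)) (k : ℕ), b.length < a.length → a ≠ b ^ k

/-- The set of primitive words. -/
def PrimitiveWord (d : ℕ) : Type := {a : FreeMonoid (Fin d) // IsPrimitive a}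

/-- Cyclic equivalence of primitive words: one is a rotation of the other. -/
def cyclicSetoid (d : ℕ) : Setoid (PrimitiveWord d) where
  r a b := a.1.toList.IsRotated b.1.toList
  iseqv :=
    { refl := fun _ => List.IsRotated.refl _
      symm := fun h => List.IsRotated.symm h
      trans := fun h h' => List.IsRotated.trans h h' }

/-- Primitive words up to cyclic equivalence. -/
def PrimitiveClass (d : ℕ) : Type := Quotient (cyclicSetoid d)

/-- The free commutative algebra on the symbols `σ_t(a)`, where `t > 0` and `a` is a primitive
word up to cyclic equivalence. -/
abbrev SigmaRing (F : Type*) [Field F] (d : ℕ) : Type _ :=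
  MvPolynomial (ℕ+ × PrimitiveClass d) F

/-- The coordinate ring of `d`-tuples of `n × n` matrices; the variable `x_{ij}(k)` is
`X (k, i, j)`. -/
abbrev CoordRing (F : Type*) [Field F] (n d : ℕ) : Type _ :=
  MvPolynomial (Fin d × Fin n × Fin n) F

/-- The generic matrix `X_k`. -/
noncomputable def genericMatrix (F : Type*) [Field F] (n d : ℕ) (k : Fin d) :
    Matrix (Fin n) (Fin n) (CoordRing F n d) :=
  Matrix.of fun i j => X (k, i, j)

/-- The product `X_a` of generic matrices along a word `a`. -/
noncomputable def wordMatrix (F : Type*) [Field F] (n d : ℕ) :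
    FreeMonoid (Fin d) →* Matrix (Fin n) (Fin n) (CoordRing F n d) :=
  FreeMonoid.lift (genericMatrix F n d)

/-- A matrix over `F` regarded as a matrix of constant polynomials. -/
noncomputable def constMatrix (F : Type*) [Field F] (n d : ℕ) :
    Matrix (Fin n) (Fin n) F →+* Matrix (Fin n) (Fin n) (CoordRing F n d) :=
  RingHom.mapMatrix C

/-- The action of `g ∈ GL(n)` on the coordinate ring, sending `x_{ij}(k)` to the `(i,j)` entry
of `g⁻¹ X_k g`. -/
noncomputable def act {F : Type*} [Field F] {n : ℕ} (d : ℕ) (g : GL (Fin n) F) :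
    CoordRing F n d →ₐ[F] CoordRing F n d :=
  aeval fun v : Fin d × Fin n × Fin n =>
    (constMatrix F n d (↑g⁻¹ : Matrix (Fin n) (Fin n) F) * genericMatrix F n d v.1 *
      constMatrix F n d (g : Matrix (Fin n) (Fin n) F)) v.2.1 v.2.2

/-- The algebra of matrix `GL(n)`-invariants. -/
noncomputable def invariants (F : Type*) [Field F] (n d : ℕ) :
    Subalgebra F (CoordRing F n d) :=
  ⨅ g : GL (Fin n) F, AlgHom.equalizer (act d g) (AlgHom.id F (CoordRing F n d))

/-- `σ_t(A)` for `t ≤ n`: the coefficient of `λ^(n-t)` in `det (A + λ E)`. -/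
noncomputable def sigma {R : Type*} [CommRing R] {n : ℕ} (t : ℕ)
    (A : Matrix (Fin n) (Fin n) R) : R :=
  (A.map Polynomial.C + (Polynomial.X : Polynomial R) • 1).det.coeff (n - t)

theorem sigma_eq_charpoly {R : Type*} [CommRing R] {n : ℕ} (t : ℕ)
    (A : Matrix (Fin n) (Fin n) R) : sigma t A = (-A).charpoly.coeff (n - t) := by
  unfold sigma Matrix.charpoly Matrix.charmatrix
  congr 2
  ext i j
  simp [Matrix.smul_one_eq_diagonal, add_comm]

theorem sigma_mul_comm {R : Type*} [CommRing R] {n : ℕ} (t : ℕ)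
    (A B : Matrix (Fin n) (Fin n) R) : sigma t (A * B) = sigma t (B * A) := by
  rw [sigma_eq_charpoly, sigma_eq_charpoly, ← Matrix.neg_mul, Matrix.charpoly_mul_comm,
    Matrix.mul_neg]

theorem sigma_map {R S : Type*} [CommRing R] [CommRing S] {n : ℕ} (f : R →+* S) (t : ℕ)
    (A : Matrix (Fin n) (Fin n) R) : f (sigma t A) = sigma t (f.mapMatrix A) := by
  rw [sigma_eq_charpoly, sigma_eq_charpoly, ← map_neg, RingHom.mapMatrix_apply,
    Matrix.charpoly_map, Polynomial.coeff_map]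

/-- `σ_t(X_a)` depends only on the cyclic equivalence class of `a`. -/
theorem sigma_wordMatrix_rotate (F : Type*) [Field F] (n d t : ℕ) (a b : FreeMonoid (Fin d))
    (h : a.toList.IsRotated b.toList) :
    sigma t (wordMatrix F n d a) = sigma t (wordMatrix F n d b) := by
  obtain ⟨k, hk⟩ := h
  have hb : b = FreeMonoid.ofList (a.toList.drop (k % a.toList.length)) *
      FreeMonoid.ofList (a.toList.take (k % a.toList.length)) := by
    apply FreeMonoid.toList.injective
    rw [← hk, List.rotate_eq_drop_append_take_mod]
    rfl
  have ha : a = FreeMonoid.ofList (a.toList.take (k % a.toList.length)) *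
      FreeMonoid.ofList (a.toList.drop (k % a.toList.length)) := by
    apply FreeMonoid.toList.injective
    exact (List.take_append_drop _ _).symm
  rw [hb]
  conv_lhs => rw [ha]
  rw [map_mul, map_mul, sigma_mul_comm]

theorem act_wordMatrix {F : Type*} [Field F] {n d : ℕ} (g : GL (Fin n) F)
    (a : FreeMonoid (Fin d)) :
    (act d g : CoordRing F n d →+* CoordRing F n d).mapMatrix (wordMatrix F n d a) =
      constMatrix F n d (↑g⁻¹ : Matrix (Fin n) (Fin n) F) * wordMatrix F n d a *
        constMatrix F n d (g : Matrix (Fin n) (Fin n) F) := by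
  have h1 : constMatrix F n d (↑g⁻¹ : Matrix (Fin n) (Fin n) F) *
      constMatrix F n d (g : Matrix (Fin n) (Fin n) F) = 1 := by
    rw [← map_mul, Units.inv_mul, map_one]
  have h2 : constMatrix F n d (g : Matrix (Fin n) (Fin n) F) *
      constMatrix F n d (↑g⁻¹ : Matrix (Fin n) (Fin n) F) = 1 := by
    rw [← map_mul, Units.mul_inv, map_one]
  induction a using FreeMonoid.recOn with
  | one => rw [map_one, map_one, mul_one, h1]
  | of_mul k w ih =>
    have hk : (act d g : CoordRing F n d →+* CoordRing F n d).mapMatrix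
        (wordMatrix F n d (FreeMonoid.of k)) =
        constMatrix F n d (↑g⁻¹ : Matrix (Fin n) (Fin n) F) *
          wordMatrix F n d (FreeMonoid.of k) *
            constMatrix F n d (g : Matrix (Fin n) (Fin n) F) := by
      simp only [wordMatrix, FreeMonoid.lift_eval_of]
      ext1 i j
      simp [genericMatrix, act]
    rw [map_mul, map_mul, ih, hk]
    simp only [mul_assoc]
    rw [← mul_assoc (constMatrix F n d (g : Matrix (Fin n) (Fin n) F)), h2, one_mul]

theorem sigma_wordMatrix_mem (F : Type*) [Field F] (n d t : ℕ) (a : FreeMonoid (Fin d)) :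
    sigma t (wordMatrix F n d a) ∈ invariants F n d := by
  rw [invariants, Algebra.mem_iInf]
  intro g
  change (act d g : CoordRing F n d →+* CoordRing F n d) _ = _
  rw [sigma_map, act_wordMatrix, sigma_mul_comm, ← mul_assoc, ← map_mul, Units.mul_inv,
    map_one, one_mul]
  rfl

/-- The image of `σ_t(a)` in the invariant algebra: `σ_t(X_a)` if `t ≤ n`, and `0` otherwise. -/
noncomputable def psiGen (F : Type*) [Field F] (n d : ℕ) (v : ℕ+ × PrimitiveClass d) :
    invariants F n d :=
  Quotient.lift (s := cyclicSetoid d)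
    (fun a => if (v.1 : ℕ) ≤ n then
      (⟨sigma v.1 (wordMatrix F n d a.1), sigma_wordMatrix_mem F n d v.1 a.1⟩ :
        invariants F n d) else 0)
    (fun a b h => by
      have := sigma_wordMatrix_rotate F n d v.1 a.1 b.1 h
      simp only [this]) v.2

/-- The homomorphism `Ψ_n` from the free algebra on the `σ_t(a)` to the algebra of invariants. -/
noncomputable def psi (F : Type*) [Field F] (n d : ℕ) :
    SigmaRing F d →ₐ[F] invariants F n d :=
  aeval (psiGen F n d)

/-- The ideal `K_n` of relations for the `GL(n)`-invariants of `d` matrices. -/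
noncomputable def relations (F : Type*) [Field F] (n d : ℕ) : Ideal (SigmaRing F d) :=
  RingHom.ker (psi F n d)

/-- The ideal `K_∞` of free relations: those valid for matrices of every order `n > 0`. -/
noncomputable def freeRelations (F : Type*) [Field F] (d : ℕ) : Ideal (SigmaRing F d) :=
  ⨅ n : ℕ, ⨅ _ : 0 < n, relations F n d

end MatrixInvariants

/-! A nonzero `f` has a non-root `p` over the algebraic closure, so it suffices to find matrices
over that closure, of some order `n`, whose `σ_t(X_a)` equal `p (t, a)` for the finitely many
symbols in `f`. For one primitive word `a`, take the cycle with edges labelled by `a` and weight `y`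
on the first edge. Products of its labelled adjacency matrices count paths. Primitivity makes `X_a`
equal to `y` times a single diagonal matrix unit (`cycleRep_self`), and makes `X_b` nilpotent when
`b` is primitive and not a rotation of `a` (`isNilpotent_cycleRep`). Hence `det (1 + λ X_b)` is `1 +
y λ` for `b = a` and `1` for the other classes. A block sum of such cycles multiplies these
determinants, and any polynomial with constant term `1` splits into factors `1 + y λ`, so all
required values are attained at once (`exists_matrix_sigma_eq`). -/

namespace MatrixInvariants

/-! ### Periods of primitive words -/

/-- The `i`-th letter of the periodic infinite word `a a a ⋯`. -/
def letter {d : ℕ} (a : FreeMonoid (Fin d)) (i : ℕ) : Option (Fin d) :=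
  a.toList[i % a.length]?

theorem letter_of_lt {d : ℕ} {a : FreeMonoid (Fin d)} {i : ℕ} (hi : i < a.length) :
    letter a i = a.toList[i]? := by
  rw [letter, Nat.mod_eq_of_lt hi]

theorem letter_mod {d : ℕ} (a : FreeMonoid (Fin d)) (i : ℕ) :
    letter a (i % a.length) = letter a i := by
  rw [letter, letter, Nat.mod_mod]

theorem periodic_letter {d : ℕ} (a : FreeMonoid (Fin d)) :
    Function.Periodic (letter a) a.length := fun i => by
  rw [letter, letter, Nat.add_mod_right]

theorem length_pow {d : ℕ} (b : FreeMonoid (Fin d)) (k : ℕ) :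
    (b ^ k).length = k * b.length := by
  induction k with
  | zero => simp
  | succ k ih => rw [pow_succ, FreeMonoid.length_mul, ih, Nat.succ_mul]

theorem getElem?_pow {d : ℕ} (b : FreeMonoid (Fin d)) (k : ℕ) {i : ℕ}
    (hi : i < k * b.length) : (b ^ k).toList[i]? = letter b i := by
  induction k generalizing i with
  | zero => simp at hi
  | succ k ih =>
    rw [pow_succ', FreeMonoid.toList_mul]
    have hl : b.toList.length = b.length := rfl
    rcases lt_or_ge i b.length with h | h
    · rw [List.getElem?_append_left h, letter_of_lt h]
    · rw [List.getElem?_append_right h, hl, ih (by rw [Nat.succ_mul] at hi; omega)]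
      rw [← periodic_letter b, Nat.sub_add_cancel h]

theorem length_pos_of_isPrimitive {d : ℕ} {a : FreeMonoid (Fin d)} (ha : IsPrimitive a) :
    0 < a.length :=
  Nat.pos_of_ne_zero fun h => ha.1 (FreeMonoid.length_eq_zero.1 h)

/-- The length of a primitive word `a` divides every period of `a a a ⋯`. -/
theorem IsPrimitive.length_dvd {d : ℕ} {a : FreeMonoid (Fin d)} (ha : IsPrimitive a) {c : ℕ}
    (hc : Function.Periodic (letter a) c) : a.length ∣ c := by
  by_contra hndvd
  have hpos := length_pos_of_isPrimitive ha
  set r := a.length with hr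
  set g := Nat.gcd c r with hg
  have hglt : g < r := lt_of_le_of_ne (Nat.le_of_dvd hpos (Nat.gcd_dvd_right _ _))
    fun h => hndvd (Nat.gcd_eq_right_iff_dvd.1 h)
  have hgpos : 0 < g := Nat.gcd_pos_of_pos_right _ hpos
  -- Bézout modulo `r`: `c * m` is congruent to `g`, so `g` is itself a period.
  obtain ⟨m, -, hm⟩ := Nat.exists_mul_mod_eq_gcd hglt
  have hper : Function.Periodic (letter a) g := fun i => by
    have h1 : i + c * m = i + g + (c * m / r) * r := by
      have := Nat.mod_add_div (c * m) r
      rw [hm, ← hg] at this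
      rw [mul_comm (c * m / r) r, add_assoc, this]
    have h2 := (periodic_letter a).nat_mul (c * m / r) (i + g)
    have h3 := hc.nat_mul m i
    simp only [Nat.cast_id] at h2 h3
    rw [← h3, mul_comm m c, h1]
    exact h2.symm
  have hb : (FreeMonoid.ofList (a.toList.take g)).length = g := by
    change (a.toList.take g).length = g
    rw [List.length_take]
    exact min_eq_left hglt.le
  have hmul : r / g * g = r := Nat.div_mul_cancel (Nat.gcd_dvd_right _ _)
  -- `a` would be a power of its prefix of length `g < r`.
  refine ha.2 (FreeMonoid.ofList (a.toList.take g)) (r / g) (by rw [hb]; exact hglt) ?_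
  apply FreeMonoid.toList.injective
  apply List.ext_getElem?
  intro i
  rcases lt_or_ge i r with hi | hi
  · rw [getElem?_pow _ _ (by rw [hb, hmul]; exact hi), ← letter_of_lt hi]
    conv_rhs => rw [letter, hb]
    rw [FreeMonoid.toList_ofList, List.getElem?_take_of_lt (Nat.mod_lt _ hgpos),
      ← letter_of_lt ((Nat.mod_lt _ hgpos).trans hglt), hper.map_mod_nat]
  · rw [List.getElem?_eq_none hi, List.getElem?_eq_none]
    change (_ ^ _ : FreeMonoid (Fin d)).length ≤ i
    rw [length_pow, hb, hmul]
    exact hi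

theorem isRotated_of_letter_eq {d : ℕ} {a b : FreeMonoid (Fin d)} (ha : IsPrimitive a)
    (hb : IsPrimitive b) (i : ℕ) (h : ∀ k, letter b k = letter a (i + k)) :
    a.toList.IsRotated b.toList := by
  have hap := length_pos_of_isPrimitive ha
  have h1 : b.length ∣ a.length := hb.length_dvd fun k => by
    rw [h, h, ← add_assoc, periodic_letter a]
  -- Modulo the period, shifting back by `i` is shifting forward by `i * (a.length - 1)`; thus each
  -- length is a period of the other word.
  have hshift : ∀ k, letter a k = letter b (k + i * (a.length - 1)) := fun k => by
    have h2 := (periodic_letter a).nat_mul i k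
    simp only [Nat.cast_id] at h2
    rw [h, ← h2]
    congr 1
    obtain ⟨r, hr⟩ := Nat.exists_eq_add_of_lt hap
    rw [hr]
    simp
    ring
  have h2 : a.length ∣ b.length := ha.length_dvd fun k => by
    rw [hshift, hshift, add_right_comm, periodic_letter b]
  have hlen : a.length = b.length := Nat.dvd_antisymm h2 h1
  refine ⟨i, List.ext_getElem? fun k => ?_⟩
  rcases lt_or_ge k a.length with hk | hk
  · rw [List.getElem?_rotate hk, ← letter_of_lt (a := b) (hlen ▸ hk), h, letter, add_comm k i]
    rfl
  · rw [List.getElem?_eq_none (by rw [List.length_rotate]; exact hk),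
      List.getElem?_eq_none (hlen ▸ hk : b.length ≤ k)]

end MatrixInvariants
-- Matrices of labelled cycles
namespace MatrixInvariants

/-- The `k`-labelled weighted adjacency matrix of the cycle whose consecutive edges are labelled
by the letters of `a`, with weight `y` on the first edge and `1` on the others. The vertices
`a.length, …, L - 1` are isolated. -/
def cycleMatrix {K : Type*} [Field K] {d : ℕ} (L : ℕ) (a : FreeMonoid (Fin d)) (y : K)
    (k : Fin d) : Matrix (Fin L) (Fin L) K :=
  Matrix.of fun i j => if a.toList[(i : ℕ)]? = some k ∧ (j : ℕ) = (i + 1) % a.length then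
    (if (i : ℕ) = 0 then y else 1) else 0

/-- The product of the matrices `cycleMatrix` along a word. -/
def cycleRep {K : Type*} [Field K] {d : ℕ} (L : ℕ) (a : FreeMonoid (Fin d)) (y : K) :
    FreeMonoid (Fin d) →* Matrix (Fin L) (Fin L) K :=
  FreeMonoid.lift (cycleMatrix L a y)

section cycleRep

variable {K : Type*} [Field K] {d L : ℕ} {a : FreeMonoid (Fin d)} {y : K}

theorem cycleRep_of_mul {k : Fin d} {i i' : Fin L} (hk : a.toList[(i : ℕ)]? = some k)
    (hi : (i' : ℕ) = (i + 1) % a.length) (b : FreeMonoid (Fin d)) (j : Fin L) :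
    cycleRep L a y (FreeMonoid.of k * b) i j =
      (if (i : ℕ) = 0 then y else 1) * cycleRep L a y b i' j := by
  rw [map_mul, Matrix.mul_apply, Finset.sum_eq_single i']
  · simp [cycleRep, cycleMatrix, hk, hi]
  · intro m _ hm
    have : (m : ℕ) ≠ (i + 1) % a.length := fun h => hm (Fin.ext (h.trans hi.symm))
    simp [cycleRep, cycleMatrix, this]
  · simp

theorem cycleRep_of_mul_eq_zero {k : Fin d} {i : Fin L} (hk : a.toList[(i : ℕ)]? ≠ some k)
    (b : FreeMonoid (Fin d)) (j : Fin L) :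
    cycleRep L a y (FreeMonoid.of k * b) i j = 0 := by
  rw [map_mul, Matrix.mul_apply]
  refine Finset.sum_eq_zero fun m _ => ?_
  simp [cycleRep, cycleMatrix, hk]

/-- A nonzero entry `(i, j)` of the matrix of `b` comes from a path on the cycle of `a` which reads
`b` from vertex `i` to vertex `j`. -/
theorem of_cycleRep_ne_zero (hL : a.length ≤ L) {b : FreeMonoid (Fin d)} {i j : Fin L}
    (h : cycleRep L a y b i j ≠ 0) :
    (∀ k < b.length, b.toList[k]? = letter a (i + k)) ∧
      (j : ℕ) % a.length = (i + b.length) % a.length ∧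
      (b ≠ 1 → (i : ℕ) < a.length ∧ ((i : ℕ) < a.length → (j : ℕ) < a.length)) := by
  -- The implication on `j` is freed from `b ≠ 1`, so that the induction hypothesis still applies to
  -- an empty tail.
  suffices H : (∀ k < b.length, b.toList[k]? = letter a (i + k)) ∧
      (j : ℕ) % a.length = (i + b.length) % a.length ∧
      ((i : ℕ) < a.length → (j : ℕ) < a.length) ∧ (b ≠ 1 → (i : ℕ) < a.length) from
    ⟨H.1, H.2.1, fun hb => ⟨H.2.2.2 hb, H.2.2.1⟩⟩
  induction b using FreeMonoid.recOn generalizing i with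
  | one =>
    have hij : i = j := by
      by_contra hij
      exact h (by rw [map_one, Matrix.one_apply_ne hij])
    subst hij
    simp
  | of_mul c b ih =>
    have hc : a.toList[(i : ℕ)]? = some c := by
      by_contra hc
      exact h (cycleRep_of_mul_eq_zero hc b j)
    have hi : (i : ℕ) < a.length := (List.getElem?_eq_some_iff.1 hc).1
    have hlt := Nat.mod_lt (i + 1) (Nat.zero_lt_of_lt hi)
    rw [cycleRep_of_mul (i' := ⟨(i + 1) % a.length, hlt.trans_le hL⟩) hc rfl] at h
    obtain ⟨h1, h2, h3, -⟩ := ih (right_ne_zero_of_mul h)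
    refine ⟨fun k hk => ?_, ?_, fun _ => h3 hlt, fun _ => hi⟩
    · rw [FreeMonoid.toList_of_mul]
      cases k with
      | zero => rw [add_zero, letter_of_lt hi, hc]; rfl
      | succ k =>
        rw [FreeMonoid.length_mul, FreeMonoid.length_of] at hk
        rw [List.getElem?_cons_succ, h1 k (by omega), ← letter_mod, Nat.mod_add_mod, letter_mod,
          add_assoc, add_comm 1 k]
    · rw [h2, Nat.mod_add_mod, FreeMonoid.length_mul, FreeMonoid.length_of, add_assoc]

/-- The matrix of a primitive word which is not a rotation of `a` is nilpotent. -/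
theorem isNilpotent_cycleRep (hL : a.length ≤ L) (ha : IsPrimitive a) {b : FreeMonoid (Fin d)}
    (hb : IsPrimitive b) (hab : ¬ a.toList.IsRotated b.toList) :
    IsNilpotent (cycleRep L a y b) := by
  refine ⟨a.length, ?_⟩
  rw [← map_pow]
  ext i j
  by_contra h
  have h1 := (of_cycleRep_ne_zero hL h).1
  rw [length_pow] at h1
  -- The path reads `a.length * b.length` letters, a common multiple of both periods, so the
  -- agreement extends to all `k`.
  refine hab (isRotated_of_letter_eq ha hb i fun k => ?_)
  have hpos : 0 < a.length * b.length :=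
    Nat.mul_pos (length_pos_of_isPrimitive ha) (length_pos_of_isPrimitive hb)
  have hk := Nat.mod_lt k hpos
  have h2 := h1 _ hk
  rw [getElem?_pow _ _ hk] at h2
  rw [← letter_mod b, ← Nat.mod_mod_of_dvd k (Nat.dvd_mul_left b.length a.length), letter_mod, h2,
    ← letter_mod a, Nat.add_mod, Nat.mod_mod_of_dvd k (Nat.dvd_mul_right a.length b.length),
    ← Nat.add_mod, letter_mod]

/-- Once the nonempty prefix `v` has been read, the rest of the loop avoids the first edge, so the
weight `y` never enters. The remainder in `hi` covers empty `u`, where the vertex is `0` again. -/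
theorem cycleRep_suffix (hL : a.length ≤ L) (h0 : 0 < L) (u v : FreeMonoid (Fin d))
    (huv : a = v * u) (hv : v ≠ 1) {i : Fin L} (hi : (i : ℕ) = v.length % a.length) :
    cycleRep L a y u i ⟨0, h0⟩ = 1 := by
  induction u using FreeMonoid.recOn generalizing v i with
  | one =>
    have : i = ⟨0, h0⟩ := Fin.ext (by rw [hi, huv, mul_one, Nat.mod_self])
    rw [this, map_one, Matrix.one_apply_eq]
  | of_mul c u ih =>
    have hlen : v.length < a.length := by
      rw [huv, FreeMonoid.length_mul, FreeMonoid.length_mul, FreeMonoid.length_of]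
      omega
    rw [Nat.mod_eq_of_lt hlen] at hi
    have hc : a.toList[(i : ℕ)]? = some c := by
      rw [hi, huv, FreeMonoid.toList_mul, List.getElem?_append_right (le_refl v.length)]
      simp [FreeMonoid.length]
    have hi0 : (i : ℕ) ≠ 0 := by
      rw [hi]
      exact fun h => hv (FreeMonoid.length_eq_zero.1 h)
    have hlt := Nat.mod_lt (i + 1) (Nat.zero_lt_of_lt hlen)
    rw [cycleRep_of_mul (i' := ⟨(i + 1) % a.length, hlt.trans_le hL⟩) hc rfl, if_neg hi0, one_mul]
    refine ih (v * FreeMonoid.of c) (by rw [huv, mul_assoc]) (fun h => ?_) ?_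
    · have := congrArg FreeMonoid.length h
      simp at this
    · simp [hi]

/-- The matrix of a primitive word on its own cycle has a single nonzero entry `y`. -/
theorem cycleRep_self (hL : a.length ≤ L) (ha : IsPrimitive a) (h0 : 0 < L) :
    cycleRep L a y a = Matrix.diagonal (Pi.single ⟨0, h0⟩ y) := by
  have hpos := length_pos_of_isPrimitive ha
  have h00 : cycleRep L a y a ⟨0, h0⟩ ⟨0, h0⟩ = y := by
    obtain ⟨c, u, hcu⟩ : ∃ c u, a = FreeMonoid.of c * u := by
      induction a using FreeMonoid.casesOn with
      | one => exact absurd rfl ha.1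
      | of_mul c u => exact ⟨c, u, rfl⟩
    have hlt := Nat.mod_lt (0 + 1) hpos
    have hc : a.toList[0]? = some c := by
      rw [hcu]
      simp
    have h := cycleRep_of_mul (y := y) (i := ⟨0, h0⟩)
      (i' := ⟨(0 + 1) % a.length, hlt.trans_le hL⟩) hc rfl u ⟨0, h0⟩
    rwa [← hcu, if_pos rfl, cycleRep_suffix hL h0 u (FreeMonoid.of c) hcu
      (FreeMonoid.of_ne_one c) (by simp), mul_one] at h
  ext i j
  by_cases hij : i = ⟨0, h0⟩ ∧ j = ⟨0, h0⟩
  · rw [hij.1, hij.2, h00]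
    simp
  · have hz : cycleRep L a y a i j = 0 := by
      by_contra h
      obtain ⟨h1, h2, h3⟩ := of_cycleRep_ne_zero hL h
      obtain ⟨hi, hj⟩ := h3 ha.1
      -- Reading `a` from vertex `i` makes `i` a period; being less than `a.length`, it is `0`.
      have hper : Function.Periodic (letter a) i := fun k => by
        rw [← letter_mod a k, letter_of_lt (Nat.mod_lt k hpos), h1 _ (Nat.mod_lt k hpos),
          ← letter_mod a (k + i), Nat.add_comm k, Nat.add_mod, ← letter_mod a (i + k % a.length),
          Nat.add_mod i (k % a.length), Nat.mod_mod]
      have hi0 := Nat.eq_zero_of_dvd_of_lt (ha.length_dvd hper) hi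
      rw [hi0, zero_add, Nat.mod_self, Nat.mod_eq_of_lt (hj hi)] at h2
      exact hij ⟨Fin.ext hi0, Fin.ext h2⟩
    rw [hz, Matrix.diagonal_apply]
    split_ifs with h
    · subst h
      rw [Pi.single_eq_of_ne fun h => hij ⟨h, h⟩]
    · rfl

-- Nilpotency makes this polynomial a unit, hence constant, and its value at `0` is `1`.
open Polynomial in
theorem charpolyRev_neg_cycleRep_of_not_isRotated (hL : a.length ≤ L) (ha : IsPrimitive a)
    {b : FreeMonoid (Fin d)} (hb : IsPrimitive b) (hab : ¬ a.toList.IsRotated b.toList) :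
    (-cycleRep L a y b).charpolyRev = 1 := by
  have h := Matrix.isUnit_charpolyRev_of_isNilpotent (isNilpotent_cycleRep (y := y) hL ha hb hab).neg
  obtain ⟨c, -, hc⟩ := Polynomial.isUnit_iff.1 h
  have h1 := Matrix.eval_charpolyRev (M := -cycleRep L a y b)
  rw [← hc, eval_C] at h1
  rw [← hc, h1, map_one]

open Polynomial in
theorem charpolyRev_neg_cycleRep_self (hL : a.length ≤ L) (ha : IsPrimitive a) :
    (-cycleRep L a y a).charpolyRev = 1 + C y * X := by
  have h0 : 0 < L := (length_pos_of_isPrimitive ha).trans_le hL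
  have hmat : (1 - (X : K[X]) • (-cycleRep L a y a).map C) =
      Matrix.diagonal (1 + Pi.single (⟨0, h0⟩ : Fin L) (C y * X)) := by
    rw [cycleRep_self hL ha h0]
    ext1 i j
    rcases eq_or_ne i j with rfl | hij
    · rcases eq_or_ne i ⟨0, h0⟩ with rfl | hi
      · simp [-map_neg, X_mul_C]
        rw [C_neg, neg_mul, sub_neg_eq_add]
      · simp [Pi.single_eq_of_ne hi]
    · simp [hij]
  rw [Matrix.charpolyRev, hmat, Matrix.det_diagonal, Finset.prod_eq_single ⟨0, h0⟩]
  · simp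
  · intro i _ hi
    simp [Pi.single_eq_of_ne hi]
  · simp

end cycleRep

end MatrixInvariants
-- Prescribing the values of `σ_t`
namespace MatrixInvariants

open Polynomial in
/-- Over an algebraically closed field, a polynomial with constant term `1` and degree at most `T`
is a product of `T` factors `1 + y X`. -/
theorem exists_prod_one_add_C_mul_X {K : Type*} [Field K] [IsAlgClosed K] (T : ℕ) (P : K[X])
    (h0 : P.coeff 0 = 1) (hT : P.natDegree ≤ T) :
    ∃ y : Fin T → K, ∏ i, (1 + C (y i) * X) = P := by
  induction T generalizing P with
  | zero =>
    refine ⟨fun _ => 0, ?_⟩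
    rw [eq_C_of_natDegree_le_zero hT, h0]
    simp
  | succ T ih =>
    rcases Nat.eq_zero_or_pos P.natDegree with hd | hd
    · refine ⟨fun _ => 0, ?_⟩
      rw [eq_C_of_natDegree_eq_zero hd, h0]
      simp
    · obtain ⟨r, hr⟩ := IsAlgClosed.exists_root P (natDegree_pos_iff_degree_pos.1 hd).ne'
      obtain ⟨Q, hQ⟩ := dvd_iff_isRoot.2 hr
      have hP : P ≠ 0 := by
        rintro rfl
        simp at h0
      have hr0 : r ≠ 0 := by
        rintro rfl
        rw [hQ] at h0
        simp at h0
      have hQ0 : Q ≠ 0 := by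
        rintro rfl
        exact hP (by rw [hQ, mul_zero])
      -- The root `r` is nonzero because `P` has constant term `1`, so `X - r` can be rescaled to `1
      -- - r⁻¹ X`.
      have hfac : P = (1 + C (-r⁻¹) * X) * (C (-r) * Q) := by
        have : (C r⁻¹ * C r : K[X]) = 1 := by rw [← C_mul, inv_mul_cancel₀ hr0, C_1]
        rw [hQ, C_neg, C_neg]
        linear_combination -(X * Q) * this
      obtain ⟨y, hy⟩ := ih (C (-r) * Q) (by
        rw [hfac] at h0
        simpa [mul_coeff_zero] using h0) (by
        rw [natDegree_C_mul (neg_ne_zero.2 hr0)]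
        rw [hQ, natDegree_mul (X_sub_C_ne_zero r) hQ0, natDegree_X_sub_C] at hT
        omega)
      refine ⟨Fin.cons (-r⁻¹) y, ?_⟩
      rw [Fin.prod_univ_succ]
      simp only [Fin.cons_zero, Fin.cons_succ]
      rw [hy, ← hfac]

/-- `(-A).charpolyRev` is `det (1 + X A)`, the generating polynomial of the `σ_t(A)`. For `t > n`
the truncated `n - t` would give `det A` instead of `0`. -/
theorem sigma_eq_coeff_charpolyRev {R : Type*} [CommRing R] [Nontrivial R] {n t : ℕ} (ht : t ≤ n)
    (A : Matrix (Fin n) (Fin n) R) : sigma t A = (-A).charpolyRev.coeff t := by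
  rw [sigma_eq_charpoly, ← Matrix.reverse_charpoly, Polynomial.coeff_reverse,
    Matrix.charpoly_natDegree_eq_dim, Fintype.card_fin, Polynomial.revAt_le ht]

theorem charpolyRev_reindex {R m n : Type*} [CommRing R] [Fintype m] [DecidableEq m] [Fintype n]
    [DecidableEq n] (e : m ≃ n) (A : Matrix m m R) :
    (Matrix.reindex e e A).charpolyRev = A.charpolyRev := by
  rw [← Matrix.reverse_charpoly, Matrix.charpoly_reindex, Matrix.reverse_charpoly]

theorem charpolyRev_blockDiagonal {R m o : Type*} [CommRing R] [Fintype m] [DecidableEq m]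
    [Fintype o] [DecidableEq o] (A : o → Matrix m m R) :
    (Matrix.blockDiagonal A).charpolyRev = ∏ p, (A p).charpolyRev := by
  simp only [Matrix.charpolyRev]
  rw [← Matrix.det_blockDiagonal]
  congr 1
  rw [Matrix.blockDiagonal_map _ _ (map_zero _), ← Matrix.blockDiagonal_smul,
    ← Matrix.blockDiagonal_one, ← Matrix.blockDiagonal_sub]
  rfl

/-- The product, along a word, of block diagonal matrices with blocks `cycleMatrix`. -/
theorem lift_reindex_blockDiagonal {K o : Type*} [Field K] [Fintype o] [DecidableEq o]
    {d L n : ℕ} (e : Fin L × o ≃ Fin n) (a : o → FreeMonoid (Fin d)) (y : o → K)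
    (b : FreeMonoid (Fin d)) :
    FreeMonoid.lift (fun k => Matrix.reindex e e
        (Matrix.blockDiagonal fun p => cycleMatrix L (a p) (y p) k)) b =
      Matrix.reindex e e (Matrix.blockDiagonal fun p => cycleRep L (a p) (y p) b) := by
  induction b using FreeMonoid.recOn with
  | one =>
    have : (fun p => cycleRep L (a p) (y p) 1) = 1 := funext fun p => map_one _
    rw [this, map_one, Matrix.blockDiagonal_one]
    exact (map_one (Matrix.reindexAlgEquiv K K e)).symm
  | of_mul k b ih =>
    have : (fun p => cycleRep L (a p) (y p) (FreeMonoid.of k * b)) =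
        fun p => cycleMatrix L (a p) (y p) k * cycleRep L (a p) (y p) b := funext fun p => by
      rw [map_mul, cycleRep, FreeMonoid.lift_eval_of]
    rw [this, map_mul, ih, FreeMonoid.lift_eval_of, Matrix.blockDiagonal_mul]
    exact (map_mul (Matrix.reindexAlgEquiv K K e) _ _).symm

/-- The value of `σ_t(X_a)` at a tuple of matrices. -/
theorem aeval_sigma_wordMatrix {F K : Type*} [Field F] [Field K] [Algebra F K] {n d : ℕ}
    (M : Fin d → Matrix (Fin n) (Fin n) K) (t : ℕ) (a : FreeMonoid (Fin d)) :
    MvPolynomial.aeval (fun v : Fin d × Fin n × Fin n => M v.1 v.2.1 v.2.2)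
      (sigma t (wordMatrix F n d a)) = sigma t (FreeMonoid.lift M a) := by
  set φ : CoordRing F n d →ₐ[F] K :=
    MvPolynomial.aeval (fun v : Fin d × Fin n × Fin n => M v.1 v.2.1 v.2.2) with hφ
  have h := sigma_map (φ : CoordRing F n d →+* K) t (wordMatrix F n d a)
  refine h.trans (congrArg _ ?_)
  change (RingHom.mapMatrix (m := Fin n) (φ : CoordRing F n d →+* K)).toMonoidHom
    (FreeMonoid.lift _ a) = _
  rw [FreeMonoid.hom_map_lift]
  congr 2
  funext k
  ext i j
  simp [genericMatrix, hφ]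

/-- If a tuple of `n × n` matrices gives the variables of `f` the values of a non-root of `f`, then
`f` is not a relation for `n × n` matrices. -/
theorem psi_ne_zero {F K : Type*} [Field F] [Field K] [Algebra F K] {n d : ℕ} {f : SigmaRing F d}
    {p : ℕ+ × PrimitiveClass d → K} (hp : MvPolynomial.aeval p f ≠ 0)
    (M : Fin d → Matrix (Fin n) (Fin n) K)
    (hM : ∀ v ∈ f.vars, (v.1 : ℕ) ≤ n ∧
      sigma v.1 (FreeMonoid.lift M (Quotient.out (s := cyclicSetoid d) v.2).1) = p v) :
    psi F n d f ≠ 0 := by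
  intro h
  apply hp
  set φ : CoordRing F n d →ₐ[F] K :=
    MvPolynomial.aeval (fun v : Fin d × Fin n × Fin n => M v.1 v.2.1 v.2.2) with hφ
  have h1 : MvPolynomial.aeval p f = (φ.comp (invariants F n d).val) (psi F n d f) := by
    change _ = ((φ.comp (invariants F n d).val).comp (psi F n d)) f
    -- The two homomorphisms need only agree on the variables occurring in `f`.
    refine MvPolynomial.hom_congr_vars (f₁ := (MvPolynomial.aeval p : _ →ₐ[F] K).toRingHom)
      (f₂ := ((φ.comp (invariants F n d).val).comp (psi F n d)).toRingHom)
      ?_ (fun v hv _ => ?_) rfl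
    · ext x
      simp
    · obtain ⟨hle, hs⟩ := hM v hv
      have h2 : psiGen F n d v = ⟨_, sigma_wordMatrix_mem F n d v.1
          (Quotient.out (s := cyclicSetoid d) v.2).1⟩ := by
        obtain ⟨t, c⟩ := v
        conv_lhs => rw [← Quotient.out_eq (s := cyclicSetoid d) c]
        exact if_pos hle
      change MvPolynomial.aeval p (MvPolynomial.X v) = φ (psi F n d (MvPolynomial.X v)).1
      rw [psi, MvPolynomial.aeval_X, MvPolynomial.aeval_X, h2, ← hs, hφ, aeval_sigma_wordMatrix]
  rw [h1, h, map_zero]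

open Polynomial in
/-- Finitely many values `σ_t(X_a)`, `1 ≤ t ≤ T`, can be prescribed arbitrarily on matrices of a
suitable order over an algebraically closed field. -/
theorem exists_matrix_sigma_eq {K : Type*} [Field K] [IsAlgClosed K] {d : ℕ}
    (S : Finset (PrimitiveClass d)) (hS : S.Nonempty) (T : ℕ) (hT : 0 < T)
    (p : ℕ+ × PrimitiveClass d → K) :
    ∃ (n : ℕ) (M : Fin d → Matrix (Fin n) (Fin n) K), 0 < n ∧
      ∀ v : ℕ+ × PrimitiveClass d, (v.1 : ℕ) ≤ T → v.2 ∈ S → (v.1 : ℕ) ≤ n ∧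
        sigma v.1 (FreeMonoid.lift M (Quotient.out (s := cyclicSetoid d) v.2).1) = p v := by
  classical
  let r : PrimitiveClass d → PrimitiveWord d := Quotient.out (s := cyclicSetoid d)
  have hr : ∀ c, IsPrimitive (r c).1 := fun c => (r c).2
  -- The target for `det (1 + X A)`, with `A` the matrix of the word representing `c`.
  let P : PrimitiveClass d → K[X] := fun c =>
    1 + ∑ i : Fin T, monomial ((i : ℕ) + 1) (p (Nat.succPNat i, c))
  have hP : ∀ c (t : ℕ+), (t : ℕ) ≤ T → (P c).coeff t = p (t, c) := fun c t ht => by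
    obtain ⟨i, rfl⟩ : ∃ i, t = Nat.succPNat i := ⟨t.natPred, (PNat.succPNat_natPred t).symm⟩
    rw [Nat.succPNat_coe] at ht
    simp only [P, coeff_add, finsetSum_coeff, coeff_monomial, Nat.succPNat_coe]
    rw [Finset.sum_eq_single (⟨i, ht⟩ : Fin T)]
    · simp [coeff_one]
    · intro j _ hj
      exact if_neg fun h => hj (Fin.ext (Nat.succ_injective h))
    · simp
  have hfac : ∀ c, ∃ y : Fin T → K, ∏ i, (1 + C (y i) * X) = P c := fun c =>
    exists_prod_one_add_C_mul_X T (P c) (by simp [P, coeff_monomial])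
      ((natDegree_add_le _ _).trans (max_le (by simp)
        (natDegree_sum_le_of_forall_le _ _ fun i _ => (natDegree_monomial_le _).trans i.2)))
  choose y hy using hfac
  -- A common block size; isolated vertices pad the shorter cycles.
  let L := S.sup fun c => (r c).1.length
  have hL : ∀ c ∈ S, (r c).1.length ≤ L := fun c hc => Finset.le_sup (f := fun c => (r c).1.length) hc
  obtain ⟨c₀, hc₀⟩ := hS
  have hLpos : 0 < L := (length_pos_of_isPrimitive (hr c₀)).trans_le (hL c₀ hc₀)
  have hSpos : 0 < S.card := Finset.card_pos.2 ⟨c₀, hc₀⟩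
  let e := Fintype.equivFin (Fin L × (S × Fin T))
  have hcard : Fintype.card (Fin L × (S × Fin T)) = L * S.card * T := by
    simp [mul_assoc]
  have hTn : T ≤ Fintype.card (Fin L × (S × Fin T)) := by
    rw [hcard]
    exact Nat.le_mul_of_pos_left T (Nat.mul_pos hLpos hSpos)
  refine ⟨_, fun k => Matrix.reindex e e (Matrix.blockDiagonal
    fun q => cycleMatrix L (r q.1).1 (y q.1 q.2) k), hT.trans_le hTn, fun v hv hvS => ?_⟩
  have hvn := hv.trans hTn
  refine ⟨hvn, ?_⟩
  rw [lift_reindex_blockDiagonal e (fun q => (r q.1).1) (fun q => y q.1 q.2),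
    sigma_eq_coeff_charpolyRev hvn]
  change (-(Matrix.reindexAlgEquiv K K e _)).charpolyRev.coeff _ = _
  rw [← map_neg, ← Matrix.blockDiagonal_neg]
  change (Matrix.reindex e e _).charpolyRev.coeff _ = _
  -- Blocks of the other classes contribute `1`; the `T` blocks of `v.2` multiply to `P v.2`.
  rw [charpolyRev_reindex, charpolyRev_blockDiagonal, Fintype.prod_prod_type,
    Finset.prod_eq_single ⟨v.2, hvS⟩]
  · have : ∀ i : Fin T, (-cycleRep L (r v.2).1 (y v.2 i) (r v.2).1).charpolyRev =
        1 + C (y v.2 i) * X := fun i => charpolyRev_neg_cycleRep_self (hL _ hvS) (hr _)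
    refine Eq.trans ?_ (hP v.2 v.1 hv)
    rw [← hy]
    exact congrArg (fun Q : K[X] => Q.coeff v.1) (Finset.prod_congr rfl fun i _ => this i)
  · intro c _ hc
    refine Finset.prod_eq_one fun i _ => ?_
    refine charpolyRev_neg_cycleRep_of_not_isRotated (hL _ c.2) (hr _) (hr _) fun h => hc ?_
    exact Subtype.ext (Quotient.out_equiv_out (s := cyclicSetoid d).1 h)
  · simp

end MatrixInvariants

/-! ### The ideal of free relations is zero -/

theorem mainTheorem2 (F : Type*) [Field F] [Infinite F] (d : ℕ) :
    MatrixInvariants.freeRelations F d = ⊥ := by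
  classical
  rw [eq_bot_iff]
  intro f hf
  rw [Ideal.mem_bot]
  by_contra hf0
  have hker : ∀ n, 0 < n → MatrixInvariants.psi F n d f = 0 := fun n hn => by
    simp only [MatrixInvariants.freeRelations, Ideal.mem_iInf] at hf
    exact hf n hn
  obtain ⟨p, hp⟩ : ∃ p : ℕ+ × MatrixInvariants.PrimitiveClass d → AlgebraicClosure F,
      MvPolynomial.aeval p f ≠ 0 := by
    by_contra! h
    apply hf0
    apply MvPolynomial.map_injective (algebraMap F (AlgebraicClosure F))
      (algebraMap F (AlgebraicClosure F)).injective
    refine MvPolynomial.funext fun p => ?_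
    rw [map_zero, map_zero, MvPolynomial.eval_map, ← MvPolynomial.aeval_def, h]
  rcases f.vars.eq_empty_or_nonempty with hv | ⟨v₀, hv₀⟩
  -- A constant `f`, the only case when `d = 0`, is detected by zero matrices of order `1`.
  · exact MatrixInvariants.psi_ne_zero (n := 1) hp 0 (by simp [hv]) (hker 1 one_pos)
  · have hle : ∀ v ∈ f.vars, (v.1 : ℕ) ≤ f.vars.sup fun v => (v.1 : ℕ) := fun v hv =>
      Finset.le_sup (f := fun v : ℕ+ × MatrixInvariants.PrimitiveClass d => (v.1 : ℕ)) hv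
    obtain ⟨n, M, hn, hM⟩ := MatrixInvariants.exists_matrix_sigma_eq (f.vars.image Prod.snd)
      ⟨_, Finset.mem_image_of_mem _ hv₀⟩ _ (v₀.1.pos.trans_le (hle v₀ hv₀)) p
    exact MatrixInvariants.psi_ne_zero hp M
      (fun v hv => hM v (hle v hv) (Finset.mem_image_of_mem _ hv)) (hker n hn)
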